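/- An $m$-choice game is a two-player win-lose coordination game (WLC-game) $G=(A,C_1,C_2,W_G)$: finite non-empty disjoint choice sets $C_1,C_2$ with $A=C_1\cup C_2$ and $\max\{|C_1|,|C_2|\}=m$, and a winning relation $W_G\subseteq C_1\times C_2$ such that every choice occurs in some winning pair. $\mathrm{CM}_m$ denotes the choice matching game, in which $|C_1|=|C_2|=m$ and $W_G$ is a perfect matching. The game is played in rounds; in each round both players simultaneously pick a choice, and play goes on until the picked pair is winning. A stage is the game together with its history, the sequence of pairs picked so far. A protocol assigns to every stage of every two-player WLC-game and every player a probability distribution on the player's choices (the two players draw independently), and it is required to be structural, i.e. invariant under all bijective renamings of choices, possibly interchanging the two players, that preserve the winning relation and the history. The expected coordination time (ECT) of a protocol in $G$ is the expected number (possibly $\infty$) of rounds until coordination when both players follow it from the empty history; the optimal ECT of a game is the minimum of the ECTs over all protocols. The wait-or-move protocol WM picks the first choice uniformly at random. In a later non-final stage (one in which no pair picked so far is winning) it proceeds as follows. If each player has so far picked only one single choice (possibly several times), then with probability $\frac12$ a player repeats his choice, and with probability $\frac12$ he picks uniformly one of the choices that coordinate with the choice of the other player. If each player has so far picked exactly two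 different choices, he picks each of his two choices with probability $\frac12$. In every other stage he picks uniformly at random. Theorem. Let $m\notin\{1,3,5\}$ and let $G$ be an $m$-choice game that is not isomorphic to $\mathrm{CM}_m$ (up to renaming of choices and players). Then the optimal ECT in $\mathrm{CM}_m$ exists, and the ECT in $G$ with WM is strictly smaller than the optimal ECT in $\mathrm{CM}_m$. -/

import Mathlib

open scoped ENNReal

noncomputable section

/-- An `n`-player win-lose coordination game. The choice sets are given as a family of types, so
they are pairwise disjoint, and the domain of choices is their disjoint union. `Win` is the
winning relation, and every choice belongs to some winning choice profile. -/
structure WLCGame (n : ℕ) where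
  Choice : Fin n → Type
  [fintypeChoice : ∀ i, Fintype (Choice i)]
  [nonemptyChoice : ∀ i, Nonempty (Choice i)]
  Win : Set (∀ i, Choice i)
  no_surely_losing : ∀ i (c : Choice i), ∃ σ ∈ Win, σ i = c

attribute [instance] WLCGame.fintypeChoice WLCGame.nonemptyChoice

namespace WLCGame

variable {n : ℕ}

/-- Choice profiles of `G`. -/
abbrev Profile (G : WLCGame n) : Type := ∀ i, G.Choice i

/-- Histories: finite sequences of choice profiles, the most recent one first. A stage of a
repeated play is a pair `(G, H)` with `H : G.History`; the initial stage is `(G, [])`. -/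
abbrev History (G : WLCGame n) : Type := List G.Profile

/-- A stage is non-final if no round played so far was won. -/
def NonFinal (G : WLCGame n) (H : G.History) : Prop := ∀ σ ∈ H, σ ∉ G.Win

/-- A renaming `(perm, map)` between the stages `(G, H)` and `(G', H')`: a permutation of the
players and a bijection between the domains. As the bijection has to send `C (perm i)` onto
`C' i`, it is given by its restrictions to these sets. It respects the winning relation and, round
by round, the history. -/
structure Renaming (G : WLCGame n) (H : G.History) (G' : WLCGame n) (H' : G'.History) where
  perm : Equiv.Perm (Fin n)
  map : ∀ i, G.Choice (perm i) ≃ G'.Choice i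
  win_iff : ∀ σ : G.Profile, σ ∈ G.Win ↔ (fun i => map i (σ (perm i))) ∈ G'.Win
  history_eq : H' = H.map (fun σ i => map i (σ (perm i)))

/-- Two games are the same up to the names of choices and players. -/
def Isomorphic (G G' : WLCGame n) : Prop := Nonempty (Renaming G [] G' [])

/-- The choice matching game with `n` players and `m` choices for each player: the winning choice
profiles are the `m` profiles in which all the players choose the same `k`. -/
def choiceMatching (n m : ℕ) [NeZero m] : WLCGame n where
  Choice := fun _ => Fin m
  Win := {σ | ∃ k : Fin m, ∀ i, σ i = k}
  no_surely_losing := fun _ c => ⟨fun _ => c, ⟨c, fun _ => rfl⟩, rfl⟩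

/-- `G` is an `m`-choice game: a two-player game whose larger choice set has `m` elements. -/
def IsChoiceGame (G : WLCGame 2) (m : ℕ) : Prop :=
  m = max (Fintype.card (G.Choice 0)) (Fintype.card (G.Choice 1))

end WLCGame

open WLCGame

/-- A structural protocol for `n`-player games: it assigns to every stage of every game and to
every player a probability distribution on the choices of this player, and it is indifferent with
respect to renamings. -/
structure Protocol (n : ℕ) where
  dist : ∀ (G : WLCGame n) (_ : G.History) (i : Fin n), PMF (G.Choice i)
  structural : ∀ (G : WLCGame n) (H : G.History) (G' : WLCGame n) (H' : G'.History)
    (ρ : Renaming G H G' H') (i : Fin n) (c : G.Choice (ρ.perm i)),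
    dist G H (ρ.perm i) c = dist G' H' i (ρ.map i c)

namespace Protocol

variable {n : ℕ}

/-- The probability that the next round played from `(G, H)` is the choice profile `σ` when the
players follow `π`, each drawing independently. -/
def roundProb (π : Protocol n) (G : WLCGame n) (H : G.History) (σ : G.Profile) : ℝ≥0∞ :=
  ∏ i, π.dist G H i (σ i)

open Classical in
/-- The probability that, when all the players follow `π` from the stage `(G, H)`, the next `k`
rounds fail and the round after them is the first one that is won; so that exactly `k + 1` rounds
are needed for coordination. -/
def coordProb (π : Protocol n) (G : WLCGame n) : ℕ → G.History → ℝ≥0∞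
  | 0, H => ∑ σ : G.Profile, if σ ∈ G.Win then π.roundProb G H σ else 0
  | k + 1, H => ∑ σ : G.Profile,
      if σ ∈ G.Win then 0 else π.roundProb G H σ * coordProb π G k (σ :: H)

/-- The expected coordination time from the (non-final) stage `(G, H)`: the expected value of the
number of rounds until coordination, which is `k + 1` with probability `coordProb k` and infinite
with the remaining probability (where `⊤ * 0 = 0`). -/
def ectFrom (π : Protocol n) (G : WLCGame n) (H : G.History) : ℝ≥0∞ :=
  (∑' k : ℕ, ((k : ℝ≥0∞) + 1) * π.coordProb G k H) + ⊤ * (1 - ∑' k : ℕ, π.coordProb G k H)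

/-- The expected coordination time in `G`, from the initial stage. -/
def ect (π : Protocol n) (G : WLCGame n) : ℝ≥0∞ := π.ectFrom G []

end Protocol

/-- `r` is the optimal expected coordination time of `G`: the minimum over all protocols. -/
def IsOptimalECT {n : ℕ} (G : WLCGame n) (r : ℝ≥0∞) : Prop :=
  IsLeast (Set.range fun π : Protocol n => π.ect G) r

open Classical in
/-- The uniform distribution on `s` (on the whole type if `s` is empty). -/
def uniformOn {α : Type} [Fintype α] [Nonempty α] (s : Finset α) : PMF α :=
  if h : s.Nonempty then PMF.uniformOfFinset s h else PMF.uniformOfFintype α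

namespace WLCGame

variable {n : ℕ}

open Classical in
/-- The choices that player `i` has selected in the previous rounds. -/
def past (G : WLCGame n) (H : G.History) (i : Fin n) : Finset (G.Choice i) :=
  Finset.univ.filter fun c => ∃ σ ∈ H, σ i = c

open Classical in
/-- The choices of player `i` in a two-player game that coordinate with a choice that the other
player has selected in the previous rounds. -/
def coordinating (G : WLCGame 2) (H : G.History) (i : Fin 2) : Finset (G.Choice i) :=
  Finset.univ.filter fun c => ∃ σ ∈ G.Win, σ i = c ∧ ∀ j, j ≠ i → σ j ∈ G.past H j

theorem mem_past (G : WLCGame n) (H : G.History) (i : Fin n) (c : G.Choice i) :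
    c ∈ G.past H i ↔ ∃ σ ∈ H, σ i = c := by
  simp [past]

theorem mem_coordinating (G : WLCGame 2) (H : G.History) (i : Fin 2) (c : G.Choice i) :
    c ∈ G.coordinating H i ↔ ∃ σ ∈ G.Win, σ i = c ∧ ∀ j, j ≠ i → σ j ∈ G.past H j := by
  simp [coordinating]

theorem coordinating_nonempty (G : WLCGame 2) (H : G.History) (i : Fin 2)
    (hH : ∀ j, (G.past H j).Nonempty) : (G.coordinating H i).Nonempty := by
  obtain ⟨j, hj⟩ : ∃ j : Fin 2, ∀ k, k ≠ i → k = j := by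
    refine ⟨1 - i, ?_⟩
    revert i; decide
  obtain ⟨d, hd⟩ := hH j
  obtain ⟨σ, hσ, rfl⟩ := G.no_surely_losing j d
  exact ⟨σ i, (mem_coordinating ..).2 ⟨σ, hσ, rfl, fun k hk => by rwa [hj k hk]⟩⟩

end WLCGame

open Classical in
/-- The distributions of the wait-or-move protocol. If both players have selected a single choice,
then with probability `1/2` keep it, and with probability `1/2` select, uniformly, a choice that
coordinates with the earlier choice of the other player. If both have selected exactly two choices,
then select one of your own previous two choices, each with probability `1/2`. In every other
stage, in particular in the initial one, select uniformly at random. -/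
def wmDist (G : WLCGame 2) (H : G.History) (i : Fin 2) : PMF (G.Choice i) :=
  if G.NonFinal H ∧ ∀ j, (G.past H j).card = 1 then
    (PMF.uniformOfFintype Bool).bind fun stay =>
      if stay then uniformOn (G.past H i) else uniformOn (G.coordinating H i)
  else if G.NonFinal H ∧ ∀ j, (G.past H j).card = 2 then
    uniformOn (G.past H i)
  else
    PMF.uniformOfFintype (G.Choice i)

theorem uniformOn_equiv {α β : Type} [Fintype α] [Nonempty α] [Fintype β] [Nonempty β]
    (e : α ≃ β) (s : Finset α) (t : Finset β) (h : ∀ a, a ∈ s ↔ e a ∈ t) (a : α) :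
    uniformOn s a = uniformOn t (e a) := by
  have hst : s.map e.toEmbedding = t := by
    ext b
    obtain ⟨a, rfl⟩ := e.surjective b
    simp [h]
  subst hst
  unfold uniformOn
  by_cases hs : s.Nonempty
  · simp only [hs, dif_pos, Finset.map_nonempty, PMF.uniformOfFinset_apply, Finset.card_map]
    by_cases ha : a ∈ s
    · rw [if_pos ha, if_pos ((h a).1 ha)]
    · rw [if_neg ha, if_neg fun hb => ha ((h a).2 hb)]
  · simp [hs, PMF.uniformOfFintype_apply, Fintype.card_congr e]

theorem WLCGame.Renaming.mem_past {n : ℕ} {G G' : WLCGame n} {H : G.History} {H' : G'.History}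
    (ρ : Renaming G H G' H') (i : Fin n) (c : G.Choice (ρ.perm i)) :
    c ∈ G.past H (ρ.perm i) ↔ ρ.map i c ∈ G'.past H' i := by
  have h : ∀ τ, τ ∈ H' ↔ ∃ σ ∈ H, (fun i => ρ.map i (σ (ρ.perm i))) = τ := fun τ => by
    have := congrArg (τ ∈ ·) ρ.history_eq
    simpa using this
  simp only [WLCGame.mem_past, h]
  simp

theorem WLCGame.Renaming.card_past {n : ℕ} {G G' : WLCGame n} {H : G.History} {H' : G'.History}
    (ρ : Renaming G H G' H') (i : Fin n) :
    (G.past H (ρ.perm i)).card = (G'.past H' i).card :=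
  Finset.card_equiv (ρ.map i) fun c => ρ.mem_past i c

theorem WLCGame.Renaming.forall_card_past {n : ℕ} {G G' : WLCGame n} {H : G.History}
    {H' : G'.History} (ρ : Renaming G H G' H') (k : ℕ) :
    (∀ j, (G.past H j).card = k) ↔ ∀ j, (G'.past H' j).card = k := by
  refine ⟨fun h j => (ρ.card_past j).symm.trans (h _), fun h j => ?_⟩
  obtain ⟨j, rfl⟩ := ρ.perm.surjective j
  exact (ρ.card_past j).trans (h j)

theorem WLCGame.Renaming.nonFinal_iff {n : ℕ} {G G' : WLCGame n} {H : G.History}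
    {H' : G'.History} (ρ : Renaming G H G' H') : G.NonFinal H ↔ G'.NonFinal H' := by
  unfold WLCGame.NonFinal
  rw [ρ.history_eq]
  simp [← ρ.win_iff]

theorem WLCGame.Renaming.exists_profile {n : ℕ} {G G' : WLCGame n} {H : G.History}
    {H' : G'.History} (ρ : Renaming G H G' H') (τ : G'.Profile) :
    ∃ σ : G.Profile, (fun i => ρ.map i (σ (ρ.perm i))) = τ := by
  have h := (Equiv.piCongrLeft G.Choice ρ.perm).symm.surjective
    (fun i => (ρ.map i).symm (τ i))
  obtain ⟨σ, hσ⟩ := h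
  refine ⟨σ, ?_⟩
  funext i
  have := congrFun hσ i
  simp only [Equiv.piCongrLeft_symm_apply] at this
  rw [this, Equiv.apply_symm_apply]

theorem WLCGame.Renaming.mem_coordinating {G G' : WLCGame 2} {H : G.History} {H' : G'.History}
    (ρ : Renaming G H G' H') (i : Fin 2) (c : G.Choice (ρ.perm i)) :
    c ∈ G.coordinating H (ρ.perm i) ↔ ρ.map i c ∈ G'.coordinating H' i := by
  rw [WLCGame.mem_coordinating, WLCGame.mem_coordinating]
  constructor
  · rintro ⟨σ, hσ, rfl, h⟩
    exact ⟨_, (ρ.win_iff σ).1 hσ, rfl, fun j hj =>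
      (ρ.mem_past j _).1 (h _ fun e => hj (ρ.perm.injective e))⟩
  · rintro ⟨τ, hτ, hc, h⟩
    obtain ⟨σ, rfl⟩ := ρ.exists_profile τ
    refine ⟨σ, (ρ.win_iff σ).2 hτ, (ρ.map i).injective hc, fun j hj => ?_⟩
    obtain ⟨j, rfl⟩ := ρ.perm.surjective j
    exact (ρ.mem_past j _).2 (h j fun e => hj (by rw [e]))

/-- The wait-or-move protocol. -/
def waitOrMove : Protocol 2 where
  dist := wmDist
  structural := by
    intro G H G' H' ρ i c
    unfold wmDist
    have h1 := and_congr ρ.nonFinal_iff (ρ.forall_card_past 1)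
    have h2 := and_congr ρ.nonFinal_iff (ρ.forall_card_past 2)
    have hp := uniformOn_equiv (ρ.map i) _ _ (ρ.mem_past i) c
    have hq := uniformOn_equiv (ρ.map i) _ _ (ρ.mem_coordinating i) c
    by_cases c1 : G.NonFinal H ∧ ∀ j, (G.past H j).card = 1
    · rw [if_pos c1, if_pos (h1.1 c1)]
      simp only [PMF.bind_apply, tsum_bool, Bool.false_eq_true, if_false, if_true, hp, hq]
    rw [if_neg c1, if_neg fun h => c1 (h1.2 h)]
    by_cases c2 : G.NonFinal H ∧ ∀ j, (G.past H j).card = 2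
    · rw [if_pos c2, if_pos (h2.1 c2)]
      exact hp
    rw [if_neg c2, if_neg fun h => c2 (h2.2 h)]
    simp [PMF.uniformOfFintype_apply, Fintype.card_congr (ρ.map i)]

end

/-! Both sides are compared with `1 + 2 * (1 - p)`, where `p` is the probability of winning the
first round.

Upper bound (`waitOrMove_ect_le`): after a lost first round, wait-or-move wins every round with
probability at least 1/2, since it suffices that exactly one player moves. So at most 2 further
rounds are expected. In the first round `p = |W| / (|C₁| |C₂|)`; this is `1/m` for the matching game
and larger for every other `m`-choice game (`inv_lt_coordProb_of_not_isomorphic`).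

Lower bound (`ChoiceMatching.le_ect`): in the matching game every protocol has `p = 1/m`, so it
remains to see that a lost first round costs at least 2 further rounds. A potential `1 + excess u`
is used, where `u` counts the edges touched by nobody. As long as an involution of the edges
exchanges the two players' histories, structurality makes the players' distributions mirror images.
The winning probability is then at most the sum of the squares of one player's probabilities, and
each square is charged to losing rounds that preserve the symmetry. The charging fails to give 2
only for `u = 1` and `u = 3`, that is, for `m = 3` and `m = 5` after the first round.

The bounds agree on the matching game, so wait-or-move is optimal there. -/

open scoped ENNReal
open WLCGame

/-! ### Expected coordination time of an arbitrary protocol -/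

namespace Protocol

variable {n : ℕ}

theorem sum_roundProb (π : Protocol n) (G : WLCGame n) (H : G.History) :
    ∑ σ : G.Profile, π.roundProb G H σ = 1 := by
  classical
  have h := Finset.prod_univ_sum (fun i => (Finset.univ : Finset (G.Choice i)))
    (fun i c => π.dist G H i c)
  rw [Fintype.piFinset_univ] at h
  unfold roundProb
  rw [← h]
  refine Finset.prod_eq_one fun i _ => ?_
  rw [← tsum_fintype (L := .unconditional _), PMF.tsum_coe]

open Classical in
/-- The probability that the next `k` rounds played from `(G, H)` fail. -/
noncomputable def failProb (π : Protocol n) (G : WLCGame n) : ℕ → G.History → ℝ≥0∞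
  | 0, _ => 1
  | k + 1, H => ∑ σ : G.Profile,
      if σ ∈ G.Win then 0 else π.roundProb G H σ * failProb π G k (σ :: H)

theorem coordProb_add_failProb (π : Protocol n) (G : WLCGame n) (k : ℕ) (H : G.History) :
    π.coordProb G k H + π.failProb G (k + 1) H = π.failProb G k H := by
  induction k generalizing H with
  | zero =>
    simp only [coordProb, failProb, mul_one]
    rw [← Finset.sum_add_distrib, ← π.sum_roundProb G H]
    refine Finset.sum_congr rfl fun σ _ => ?_
    split_ifs <;> simp
  | succ k ih =>
    rw [coordProb, failProb, ← Finset.sum_add_distrib, failProb]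
    refine Finset.sum_congr rfl fun σ _ => ?_
    split_ifs
    · simp
    · rw [← mul_add, ih]

theorem sum_coordProb_add_failProb (π : Protocol n) (G : WLCGame n) (k : ℕ) (H : G.History) :
    ∑ j ∈ Finset.range k, π.coordProb G j H + π.failProb G k H = 1 := by
  induction k with
  | zero => simp [failProb]
  | succ k ih => rw [Finset.sum_range_succ, add_assoc, coordProb_add_failProb, ih]

/-- Summation by parts: with `T` the coordination time, both sides are the expectation of `min T k`.
-/
theorem sum_mul_coordProb_add_failProb (π : Protocol n) (G : WLCGame n) (k : ℕ) (H : G.History) :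
    ∑ j ∈ Finset.range k, ((j : ℝ≥0∞) + 1) * π.coordProb G j H + k * π.failProb G k H
      = ∑ j ∈ Finset.range k, π.failProb G j H := by
  induction k with
  | zero => simp
  | succ k ih =>
    rw [Finset.sum_range_succ, Finset.sum_range_succ, ← ih, add_assoc, add_assoc]
    congr 1
    rw [← coordProb_add_failProb π G k H]
    push_cast
    ring

theorem tsum_coordProb_le_one (π : Protocol n) (G : WLCGame n) (H : G.History) :
    ∑' k, π.coordProb G k H ≤ 1 :=
  ENNReal.tsum_le_of_sum_range_le fun k =>
    (sum_coordProb_add_failProb π G k H) ▸ le_self_add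

theorem ectFrom_le_tsum_failProb (π : Protocol n) (G : WLCGame n) (H : G.History) :
    π.ectFrom G H ≤ ∑' k, π.failProb G k H := by
  -- If the tail sum is finite, the tails tend to 0, so coordination is almost sure and the `⊤` term
  -- of `ectFrom` vanishes.
  by_cases hU : ∑' k, π.failProb G k H = ⊤
  · simp [hU]
  have hS : 1 ≤ ∑' k, π.coordProb G k H := by
    have h0 := ENNReal.tendsto_atTop_zero_of_tsum_ne_top hU
    have h1 : ∀ k, 1 ≤ ∑' k, π.coordProb G k H + π.failProb G k H := fun k => by
      rw [← sum_coordProb_add_failProb π G k H]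
      gcongr
      exact ENNReal.sum_le_tsum _
    have h2 := ge_of_tendsto' (h0.const_add (∑' k, π.coordProb G k H)) h1
    simpa using h2
  rw [ectFrom, tsub_eq_zero_of_le hS, mul_zero, add_zero]
  refine ENNReal.tsum_le_of_sum_range_le fun k => ?_
  calc _ ≤ _ := le_self_add
    _ = _ := sum_mul_coordProb_add_failProb π G k H
    _ ≤ _ := ENNReal.sum_le_tsum _

open Classical in
-- Conditioning on the first round, with general weights: `w = 1` yields the total probability of
-- coordination and `w k = k + 1` the mean.
theorem tsum_mul_coordProb_succ (π : Protocol n) (G : WLCGame n) (H : G.History)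
    (w : ℕ → ℝ≥0∞) :
    ∑' k, w k * π.coordProb G (k + 1) H
      = ∑ σ : G.Profile, if σ ∈ G.Win then 0 else
          π.roundProb G H σ * ∑' k, w k * π.coordProb G k (σ :: H) := by
  simp only [coordProb, Finset.mul_sum]
  rw [Summable.tsum_finsetSum fun _ _ => ENNReal.summable]
  refine Finset.sum_congr rfl fun σ _ => ?_
  split_ifs
  · simp
  · rw [← ENNReal.tsum_mul_left]
    exact tsum_congr fun k => by ring

open Classical in
-- First-step analysis, valid also when the expectation is infinite.
theorem ectFrom_eq (π : Protocol n) (G : WLCGame n) (H : G.History) :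
    π.ectFrom G H = 1 + ∑ σ : G.Profile, if σ ∈ G.Win then 0 else
      π.roundProb G H σ * π.ectFrom G (σ :: H) := by
  have hM : ∑' k : ℕ, ((k : ℝ≥0∞) + 1) * π.coordProb G k H = ∑' k, π.coordProb G k H +
      ∑ σ : G.Profile, if σ ∈ G.Win then 0 else
        π.roundProb G H σ * ∑' k : ℕ, ((k : ℝ≥0∞) + 1) * π.coordProb G k (σ :: H) := by
    rw [← tsum_mul_coordProb_succ]
    simp only [add_mul, one_mul]
    rw [ENNReal.tsum_add, ENNReal.tsum_add, add_comm]
    congr 1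
    rw [tsum_eq_zero_add' ENNReal.summable, ← ENNReal.tsum_add]
    simp only [Nat.cast_zero, zero_mul, zero_add]
    exact tsum_congr fun k => by push_cast; ring
  have hT : ∑' k, π.coordProb G k H + (∑ σ : G.Profile, if σ ∈ G.Win then 0 else
      π.roundProb G H σ * (1 - ∑' k, π.coordProb G k (σ :: H))) = 1 := by
    have h := tsum_mul_coordProb_succ π G H fun _ => 1
    simp only [one_mul] at h
    rw [tsum_eq_zero_add' ENNReal.summable, h, coordProb, ← Finset.sum_add_distrib,
      ← Finset.sum_add_distrib]
    refine Eq.trans (Finset.sum_congr rfl fun σ _ => ?_) (π.sum_roundProb G H)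
    split_ifs
    · simp
    · rw [zero_add, ← mul_add, add_tsub_cancel_of_le (π.tsum_coordProb_le_one G _), mul_one]
  have hT' : 1 - ∑' k, π.coordProb G k H = ∑ σ : G.Profile, if σ ∈ G.Win then 0 else
      π.roundProb G H σ * (1 - ∑' k, π.coordProb G k (σ :: H)) := by
    refine Eq.trans (congrArg (· - ∑' k, π.coordProb G k H) hT.symm) ?_
    exact ENNReal.add_sub_cancel_left
      (ne_top_of_le_ne_top ENNReal.one_ne_top (π.tsum_coordProb_le_one G H))
  -- Either `S = 1`, or the `⊤` term absorbs the difference.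
  have key : ∀ S : ℝ≥0∞, S ≤ 1 → S + ⊤ * (1 - S) = 1 + ⊤ * (1 - S) := fun S hS => by
    rcases hS.eq_or_lt with rfl | h
    · rfl
    · rw [ENNReal.top_mul (tsub_pos_of_lt h).ne', add_top, add_top]
  calc π.ectFrom G H = (∑' k, π.coordProb G k H + ⊤ * (1 - ∑' k, π.coordProb G k H)) +
      ∑ σ : G.Profile, if σ ∈ G.Win then 0 else
        π.roundProb G H σ * ∑' k : ℕ, ((k : ℝ≥0∞) + 1) * π.coordProb G k (σ :: H) := by
        rw [ectFrom, hM]; ring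
    _ = _ := by
      rw [key _ (π.tsum_coordProb_le_one G H), hT', add_assoc, Finset.mul_sum,
        ← Finset.sum_add_distrib]
      congr 1
      refine Finset.sum_congr rfl fun σ _ => ?_
      split_ifs
      · simp
      · rw [ectFrom]; ring

open Classical in
/-- A bounded function on histories that does not exceed its one-round update is a lower bound
for the expected coordination time. -/
theorem le_ectFrom_of_le_step (π : Protocol n) (G : WLCGame n) (f : G.History → ℝ≥0∞)
    (hf : ∀ H, f H ≤ 2) (hstep : ∀ H, f H ≤ 1 + ∑ σ : G.Profile, if σ ∈ G.Win then 0 else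
      π.roundProb G H σ * f (σ :: H)) (H : G.History) : f H ≤ π.ectFrom G H := by
  -- The defect `2⁻¹ ^ k` is halved by each round: with `c = 1 - 2⁻¹ ^ k`, the extra half-defect
  -- times `f H ≤ 2` is at most `2⁻¹ ^ k`, which completes `c * 1` to the full cost 1 of the round.
  have key : ∀ k : ℕ, ∀ H, (1 - 2⁻¹ ^ k) * f H ≤ π.ectFrom G H := by
    intro k
    induction k with
    | zero => simp
    | succ k ih =>
      intro H
      obtain ⟨c, hc⟩ : ∃ c : ℝ≥0∞, c + 2⁻¹ ^ k = 1 :=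
        ⟨1 - 2⁻¹ ^ k, tsub_add_cancel_of_le (pow_le_one₀ zero_le (by simp))⟩
      have hk : (2⁻¹ : ℝ≥0∞) ^ k = 2⁻¹ ^ (k + 1) + 2⁻¹ ^ (k + 1) := by
        rw [pow_succ, ← mul_add, ENNReal.inv_two_add_inv_two, mul_one]
      have hfin : ∀ j : ℕ, (2⁻¹ : ℝ≥0∞) ^ j ≠ ⊤ := fun j => by simp
      have e1 : (1 : ℝ≥0∞) - 2⁻¹ ^ k = c := by
        rw [← hc]; exact ENNReal.add_sub_cancel_right (hfin k)
      have e2 : (1 : ℝ≥0∞) - 2⁻¹ ^ (k + 1) = c + 2⁻¹ ^ (k + 1) := by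
        rw [← hc, hk, ← add_assoc]; exact ENNReal.add_sub_cancel_right (hfin _)
      rw [e1] at ih
      rw [e2, ectFrom_eq]
      calc (c + 2⁻¹ ^ (k + 1)) * f H = c * f H + 2⁻¹ ^ (k + 1) * f H := add_mul ..
        _ ≤ c * (1 + ∑ σ : G.Profile, if σ ∈ G.Win then 0 else π.roundProb G H σ * f (σ :: H))
            + 2⁻¹ ^ (k + 1) * 2 := by gcongr <;> simp only [hstep, hf]
        _ = 1 + ∑ σ : G.Profile, if σ ∈ G.Win then 0 else
              π.roundProb G H σ * (c * f (σ :: H)) := by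
            rw [mul_two, ← hk, mul_add, mul_one, add_right_comm, hc, Finset.mul_sum]
            congr 1
            refine Finset.sum_congr rfl fun σ _ => ?_
            split_ifs
            · simp
            · ring
        _ ≤ _ := by
            gcongr with σ
            split_ifs
            · exact le_rfl
            · gcongr
              exact ih _
  have h0 : Filter.Tendsto (fun k : ℕ => (1 - (2⁻¹ : ℝ≥0∞) ^ k) * f H) Filter.atTop
      (nhds ((1 - 0) * f H)) := by
    refine ENNReal.Tendsto.mul_const (ENNReal.Tendsto.sub tendsto_const_nhds
      (ENNReal.tendsto_pow_atTop_nhds_zero_of_lt_one (by simp)) (by simp)) (by simp)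
  rw [tsub_zero, one_mul] at h0
  exact le_of_tendsto' h0 fun k => key k H

/-- If the failure probability is at most `1/2` in every stage of a class of stages that is
almost surely not left by failing, then coordination takes at most two rounds on average. -/
theorem ectFrom_le_two (π : Protocol n) (G : WLCGame n) (I : G.History → Prop)
    (hI : ∀ H, I H → ∀ σ ∉ G.Win, π.roundProb G H σ ≠ 0 → I (σ :: H))
    (hfail : ∀ H, I H → π.failProb G 1 H ≤ 2⁻¹) (H : G.History) (hH : I H) :
    π.ectFrom G H ≤ 2 := by
  have key : ∀ k H, I H → π.failProb G k H ≤ 2⁻¹ ^ k := by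
    intro k
    induction k with
    | zero => simp [failProb]
    | succ k ih =>
      intro H hH
      calc π.failProb G (k + 1) H ≤ π.failProb G 1 H * 2⁻¹ ^ k := by
            simp only [failProb, Finset.sum_mul, mul_one]
            gcongr with σ
            split_ifs with hσ
            · simp
            · by_cases h0 : π.roundProb G H σ = 0
              · simp [h0]
              · gcongr
                exact ih _ (hI H hH σ hσ h0)
        _ ≤ _ := by
          rw [pow_succ']
          gcongr
          exact hfail H hH
  calc π.ectFrom G H ≤ ∑' k, π.failProb G k H := π.ectFrom_le_tsum_failProb G H
    _ ≤ ∑' k : ℕ, 2⁻¹ ^ k := ENNReal.tsum_le_tsum fun k => key k H hH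
    _ = 2 := by rw [ENNReal.tsum_geometric, ENNReal.one_sub_inv_two, inv_inv]

end Protocol

/-! ### Two-player profiles and the probability of winning by keeping or moving -/

/-- The choice profile `(a, b)` of a two-player game. -/
def WLCGame.pair (G : WLCGame 2) (a : G.Choice 0) (b : G.Choice 1) : G.Profile :=
  (piFinTwoEquiv G.Choice).symm (a, b)

namespace WLCGame

variable (G : WLCGame 2)

@[simp] theorem pair_zero (a : G.Choice 0) (b : G.Choice 1) : G.pair a b 0 = a := rfl

@[simp] theorem pair_one (a : G.Choice 0) (b : G.Choice 1) : G.pair a b 1 = b := rfl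

theorem pair_eta (σ : G.Profile) : G.pair (σ 0) (σ 1) = σ :=
  (piFinTwoEquiv G.Choice).symm_apply_apply σ

theorem sum_profile (F : G.Profile → ℝ≥0∞) : ∑ σ, F σ = ∑ a, ∑ b, F (G.pair a b) := by
  rw [← Fintype.sum_prod_type' (f := fun a b => F (G.pair a b))]
  exact Fintype.sum_equiv (piFinTwoEquiv G.Choice) _ _ fun σ => congrArg F (G.pair_eta σ).symm

open Classical in
theorem past_cons {n : ℕ} (G : WLCGame n) (σ : G.Profile) (H : G.History) (i : Fin n) :
    G.past (σ :: H) i = insert (σ i) (G.past H i) := by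
  ext c
  simp [mem_past, eq_comm]

theorem nonFinal_cons {n : ℕ} (G : WLCGame n) (σ : G.Profile) (H : G.History) :
    G.NonFinal (σ :: H) ↔ σ ∉ G.Win ∧ G.NonFinal H := by
  simp [NonFinal]

theorem mem_coordinating_zero {H : G.History} {b : G.Choice 1} (hb : G.past H 1 = {b})
    (c : G.Choice 0) : c ∈ G.coordinating H 0 ↔ G.pair c b ∈ G.Win := by
  rw [mem_coordinating]
  constructor
  · rintro ⟨σ, hσ, rfl, h⟩
    have h1 := h 1 (by decide)
    rw [hb, Finset.mem_singleton] at h1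
    rwa [← h1, pair_eta]
  · intro h
    refine ⟨_, h, rfl, fun j hj => ?_⟩
    obtain rfl : j = 1 := by omega
    simp [hb]

theorem mem_coordinating_one {H : G.History} {a : G.Choice 0} (ha : G.past H 0 = {a})
    (d : G.Choice 1) : d ∈ G.coordinating H 1 ↔ G.pair a d ∈ G.Win := by
  rw [mem_coordinating]
  constructor
  · rintro ⟨σ, hσ, rfl, h⟩
    have h1 := h 0 (by decide)
    rw [ha, Finset.mem_singleton] at h1
    rwa [← h1, pair_eta]
  · intro h
    refine ⟨_, h, rfl, fun j hj => ?_⟩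
    obtain rfl : j = 0 := by omega
    simp [ha]

end WLCGame

namespace Protocol

theorem roundProb_pair (π : Protocol 2) (G : WLCGame 2) (H : G.History) (a : G.Choice 0)
    (b : G.Choice 1) : π.roundProb G H (G.pair a b) = π.dist G H 0 a * π.dist G H 1 b := by
  simp [roundProb, Fin.prod_univ_two]

theorem failProb_one_le_half {n : ℕ} (π : Protocol n) (G : WLCGame n) (H : G.History)
    (h : 2⁻¹ ≤ π.coordProb G 0 H) : π.failProb G 1 H ≤ 2⁻¹ := by
  have e := π.coordProb_add_failProb G 0 H
  have e' : π.coordProb G 0 H + π.failProb G 1 H ≤ 2⁻¹ + 2⁻¹ := by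
    rw [e, ENNReal.inv_two_add_inv_two, failProb]
  by_contra! hlt
  exact absurd e' (not_le.2 (ENNReal.add_lt_add_of_le_of_lt (by simp) h hlt))

/-- If both players keep a choice of theirs with probability `1/2`, and otherwise select a choice
that coordinates with the one the other player may keep, then they win with probability at least
`1/2`. -/
theorem half_le_coordProb (π : Protocol 2) (G : WLCGame 2) (H : G.History) (a : G.Choice 0)
    (b : G.Choice 1) (μ : PMF (G.Choice 0)) (ν : PMF (G.Choice 1))
    (h0 : ∀ c, π.dist G H 0 c = 2⁻¹ * PMF.pure a c + 2⁻¹ * μ c)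
    (h1 : ∀ d, π.dist G H 1 d = 2⁻¹ * PMF.pure b d + 2⁻¹ * ν d)
    (hμ : ∀ c, μ c ≠ 0 → G.pair c b ∈ G.Win) (hν : ∀ d, ν d ≠ 0 → G.pair a d ∈ G.Win) :
    2⁻¹ ≤ π.coordProb G 0 H := by
  classical
  have hs : ∀ {α : Type} [Fintype α] (p : PMF α), ∑ x, p x = 1 := fun p => by
    rw [← tsum_fintype (L := .unconditional _), PMF.tsum_coe]
  rw [coordProb, sum_profile]
  -- Only the two mixed terms of the product distribution are kept: one player keeps while the other
  -- moves. Each has total mass 1/4 and is carried by winning pairs.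
  calc (2⁻¹ : ℝ≥0∞) = ∑ c, ∑ d, (2⁻¹ * PMF.pure a c * (2⁻¹ * ν d)
        + 2⁻¹ * μ c * (2⁻¹ * PMF.pure b d)) := by
        simp only [Finset.sum_add_distrib, ← Finset.mul_sum, ← Finset.sum_mul, hs, mul_one]
        rw [← mul_add, ENNReal.inv_two_add_inv_two, mul_one]
    _ ≤ _ := by
      refine Finset.sum_le_sum fun c _ => Finset.sum_le_sum fun d _ => ?_
      split_ifs with hW
      · rw [roundProb_pair, h0, h1]
        calc _ ≤ _ := le_self_add (b := 2⁻¹ * PMF.pure a c * (2⁻¹ * PMF.pure b d)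
              + 2⁻¹ * μ c * (2⁻¹ * ν d))
          _ = _ := by ring
      · rw [nonpos_iff_eq_zero, add_eq_zero]
        constructor
        · by_cases hc : c = a
          · subst hc
            rw [not_not.1 fun h => hW (hν d h)]
            simp
          · simp [PMF.pure_apply, hc]
        · by_cases hd : d = b
          · subst hd
            rw [not_not.1 fun h => hW (hμ c h)]
            simp
          · simp [PMF.pure_apply, hd]

end Protocol

/-! ### Upper bound: wait-or-move after the first round -/

theorem uniformOn_apply {α : Type} [Fintype α] [Nonempty α] [DecidableEq α] (s : Finset α)
    (hs : s.Nonempty) (a : α) : uniformOn s a = if a ∈ s then (s.card : ℝ≥0∞)⁻¹ else 0 := by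
  unfold uniformOn
  rw [dif_pos hs, PMF.uniformOfFinset_apply]
  congr

theorem uniformOn_singleton {α : Type} [Fintype α] [Nonempty α] (a : α) :
    uniformOn {a} = PMF.pure a := by
  classical
  ext c
  simp [uniformOn_apply, PMF.pure_apply]

theorem uniformOn_pair {α : Type} [Fintype α] [Nonempty α] [DecidableEq α] {a a' : α}
    (h : a ≠ a') (c : α) :
    uniformOn {a, a'} c = 2⁻¹ * PMF.pure a c + 2⁻¹ * PMF.pure a' c := by
  rw [uniformOn_apply _ ⟨a, by simp⟩, Finset.card_pair h]
  by_cases h1 : c = a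
  · subst h1; simp [PMF.pure_apply, h]
  · by_cases h2 : c = a'
    · subst h2; simp [PMF.pure_apply, h1]
    · simp [PMF.pure_apply, h1, h2]

open Classical in
/-- The non-final stages that the wait-or-move protocol reaches after the first round: either both
players have selected one choice, or both have selected two, and these coordinate crosswise. -/
def WaitOrMoveStage (G : WLCGame 2) (H : G.History) : Prop :=
  G.NonFinal H ∧ ((∃ a b, G.past H 0 = {a} ∧ G.past H 1 = {b}) ∨
    ∃ a a' b b', a ≠ a' ∧ b ≠ b' ∧ G.past H 0 = {a, a'} ∧ G.past H 1 = {b, b'} ∧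
      G.pair a b' ∈ G.Win ∧ G.pair a' b ∈ G.Win)

theorem waitOrMove_dist_single {G : WLCGame 2} {H : G.History} (hH : G.NonFinal H)
    (h : ∀ j, (G.past H j).card = 1) (i : Fin 2) (c : G.Choice i) :
    waitOrMove.dist G H i c
      = 2⁻¹ * uniformOn (G.past H i) c + 2⁻¹ * uniformOn (G.coordinating H i) c := by
  change wmDist G H i c = _
  rw [wmDist, if_pos ⟨hH, h⟩]
  simp [PMF.bind_apply, PMF.uniformOfFintype_apply, add_comm]

theorem waitOrMove_dist_double {G : WLCGame 2} {H : G.History} (hH : G.NonFinal H)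
    (h : ∀ j, (G.past H j).card = 2) (i : Fin 2) :
    waitOrMove.dist G H i = uniformOn (G.past H i) := by
  change wmDist G H i = _
  rw [wmDist, if_neg fun h' => by simpa [h] using h'.2 0, if_pos ⟨hH, h⟩]

theorem waitOrMove_dist_nil (G : WLCGame 2) (i : Fin 2) :
    waitOrMove.dist G [] i = PMF.uniformOfFintype (G.Choice i) := by
  change wmDist G [] i = _
  have h : G.past [] 0 = ∅ := by ext; simp [mem_past]
  rw [wmDist, if_neg fun h' => by simpa [h] using h'.2 0,
    if_neg fun h' => by simpa [h] using h'.2 0]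

/-- In a wait-or-move stage, the protocol keeps `a` or `b`, or moves to a coordinating choice. -/
theorem WaitOrMoveStage.exists_dist {G : WLCGame 2} {H : G.History} (h : WaitOrMoveStage G H) :
    ∃ a b, ∃ (μ : PMF (G.Choice 0)) (ν : PMF (G.Choice 1)),
      (∀ c, waitOrMove.dist G H 0 c = 2⁻¹ * PMF.pure a c + 2⁻¹ * μ c) ∧
      (∀ d, waitOrMove.dist G H 1 d = 2⁻¹ * PMF.pure b d + 2⁻¹ * ν d) ∧
      (∀ c, μ c ≠ 0 → G.pair c b ∈ G.Win) ∧ (∀ d, ν d ≠ 0 → G.pair a d ∈ G.Win) ∧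
      ∀ c d, (c = a ∨ μ c ≠ 0) → (d = b ∨ ν d ≠ 0) → G.pair c d ∉ G.Win →
        WaitOrMoveStage G (G.pair c d :: H) := by
  classical
  obtain ⟨hH, ⟨a, b, ha, hb⟩ | ⟨a, a', b, b', hne, hne', ha, hb, hab', ha'b⟩⟩ := h
  · have hcard : ∀ j, (G.past H j).card = 1 := by
      rw [Fin.forall_fin_two]
      simp [ha, hb]
    have hab : G.pair a b ∉ G.Win := by
      obtain ⟨σ, hσ, h0⟩ := (G.mem_past H 0 a).1 (by simp [ha])
      have h1 := (G.mem_past H 1 (σ 1)).2 ⟨σ, hσ, rfl⟩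
      rw [hb, Finset.mem_singleton] at h1
      rw [← h0, ← h1, pair_eta]
      exact hH σ hσ
    -- This makes `G.coordinating H` nonempty, so `uniformOn` does not take its default value.
    have hpast : ∀ j, (G.past H j).Nonempty := fun j => by
      rw [← Finset.card_pos, hcard j]; exact one_pos
    have hμ : ∀ c, uniformOn (G.coordinating H 0) c ≠ 0 → G.pair c b ∈ G.Win := fun c hc => by
      rw [uniformOn_apply _ (G.coordinating_nonempty H 0 hpast)] at hc
      exact (G.mem_coordinating_zero hb c).1 (by by_contra h; simp [h] at hc)
    have hν : ∀ d, uniformOn (G.coordinating H 1) d ≠ 0 → G.pair a d ∈ G.Win := fun d hd => by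
      rw [uniformOn_apply _ (G.coordinating_nonempty H 1 hpast)] at hd
      exact (G.mem_coordinating_one ha d).1 (by by_contra h; simp [h] at hd)
    refine ⟨a, b, uniformOn (G.coordinating H 0), uniformOn (G.coordinating H 1),
      fun c => ?_, fun d => ?_, hμ, hν, fun c d hc hd hcd => ?_⟩
    · rw [waitOrMove_dist_single hH hcard, ha, uniformOn_singleton]
    · rw [waitOrMove_dist_single hH hcard, hb, uniformOn_singleton]
    · refine ⟨(G.nonFinal_cons ..).2 ⟨hcd, hH⟩, ?_⟩
      simp only [past_cons, ha, hb, pair_zero, pair_one]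
      rcases hc with rfl | hc
      · rcases hd with rfl | hd
        · exact .inl ⟨c, d, by simp, by simp⟩
        · exact absurd (hν d hd) hcd
      · rcases hd with rfl | hd
        · exact absurd (hμ c hc) hcd
        -- Both players moved: each new choice wins against the other's old one, while `(a, b)`
        -- loses, so the new choices differ from the old ones.
        · refine .inr ⟨a, c, b, d, ?_, ?_, Finset.pair_comm .., Finset.pair_comm ..,
            hν d hd, hμ c hc⟩
          · rintro rfl; exact hab (hμ _ hc)
          · rintro rfl; exact hab (hν _ hd)
  · have hcard : ∀ j, (G.past H j).card = 2 := by
      rw [Fin.forall_fin_two]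
      simp [ha, hb, hne, hne']
    have hpure : ∀ {α : Type} (x y : α), PMF.pure x y ≠ 0 → y = x := fun x y h => by
      by_contra h'; simp [PMF.pure_apply, h'] at h
    -- Choosing evenly between two choices is again keep-or-move: `a` and `b` are kept, and moving
    -- leads to `a'` and `b'`, which win crosswise.
    refine ⟨a, b, PMF.pure a', PMF.pure b', fun c => ?_, fun d => ?_, fun c hc => ?_,
      fun d hd => ?_, fun c d hc hd hcd => ⟨(G.nonFinal_cons ..).2 ⟨hcd, hH⟩, ?_⟩⟩
    · rw [waitOrMove_dist_double hH hcard, ha, uniformOn_pair hne]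
    · rw [waitOrMove_dist_double hH hcard, hb, uniformOn_pair hne']
    · rwa [hpure _ _ hc]
    · rwa [hpure _ _ hd]
    · refine .inr ⟨a, a', b, b', hne, hne', ?_, ?_, hab', ha'b⟩
      · rw [past_cons, ha, pair_zero, Finset.insert_eq_self]
        rcases hc with rfl | hc
        · simp
        · simp [hpure _ _ hc]
      · rw [past_cons, hb, pair_one, Finset.insert_eq_self]
        rcases hd with rfl | hd
        · simp
        · simp [hpure _ _ hd]

theorem WaitOrMoveStage.ectFrom_le_two {G : WLCGame 2} {H : G.History}
    (h : WaitOrMoveStage G H) : waitOrMove.ectFrom G H ≤ 2 := by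
  refine waitOrMove.ectFrom_le_two G (WaitOrMoveStage G) (fun H hH σ hσ hp => ?_)
    (fun H hH => ?_) H h
  · obtain ⟨a, b, μ, ν, h0, h1, -, -, hstep⟩ := hH.exists_dist
    rw [← G.pair_eta σ] at hσ hp ⊢
    rw [Protocol.roundProb_pair, mul_ne_zero_iff, h0, h1] at hp
    refine hstep _ _ ?_ ?_ hσ
    · by_contra! hc
      exact hp.1 (by simp [PMF.pure_apply, hc])
    · by_contra! hd
      exact hp.2 (by simp [PMF.pure_apply, hd])
  · obtain ⟨a, b, μ, ν, h0, h1, hμ, hν, -⟩ := hH.exists_dist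
    exact Protocol.failProb_one_le_half _ _ _
      (waitOrMove.half_le_coordProb G H a b μ ν h0 h1 hμ hν)

/-! ### The first round and the bound on wait-or-move -/

theorem Protocol.failProb_one_eq {n : ℕ} (π : Protocol n) (G : WLCGame n) (H : G.History) :
    π.failProb G 1 H = 1 - π.coordProb G 0 H := by
  have e := π.coordProb_add_failProb G 0 H
  rw [Protocol.failProb] at e
  refine ENNReal.eq_sub_of_add_eq' ENNReal.one_ne_top ?_
  rw [add_comm, e]

/-- A lost first round leaves each player with a single past choice, which is a wait-or-move stage;
from there at most 2 rounds are expected. -/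
theorem waitOrMove_ect_le (G : WLCGame 2) :
    waitOrMove.ect G ≤ 1 + 2 * (1 - waitOrMove.coordProb G 0 []) := by
  rw [Protocol.ect, Protocol.ectFrom_eq, ← Protocol.failProb_one_eq, Protocol.failProb, Finset.mul_sum]
  gcongr with σ
  split_ifs with hσ
  · simp
  · rw [Protocol.failProb, mul_one, mul_comm]
    gcongr
    refine WaitOrMoveStage.ectFrom_le_two ⟨fun τ hτ => ?_, .inl ⟨σ 0, σ 1, ?_, ?_⟩⟩
    · rw [List.mem_singleton.1 hτ]; exact hσ
    · ext; simp [mem_past, eq_comm]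
    · ext; simp [mem_past, eq_comm]

theorem waitOrMove_coordProb_zero_nil (G : WLCGame 2) :
    waitOrMove.coordProb G 0 [] = Nat.card G.Win *
      ((Fintype.card (G.Choice 0) : ℝ≥0∞)⁻¹ * (Fintype.card (G.Choice 1) : ℝ≥0∞)⁻¹) := by
  classical
  simp only [Protocol.coordProb, Protocol.roundProb, Fin.prod_univ_two, waitOrMove_dist_nil,
    PMF.uniformOfFintype_apply]
  rw [← Finset.sum_filter, Finset.sum_const, nsmul_eq_mul, Nat.card_eq_fintype_card,
    Fintype.card_subtype]

theorem WLCGame.card_choice_le_card_win {n : ℕ} (G : WLCGame n) (i : Fin n) :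
    Fintype.card (G.Choice i) ≤ Nat.card G.Win := by
  rw [← Nat.card_eq_fintype_card]
  refine Nat.card_le_card_of_surjective (fun σ : G.Win => σ.1 i) fun c => ?_
  obtain ⟨σ, hσ, h⟩ := G.no_surely_losing i c
  exact ⟨⟨σ, hσ⟩, h⟩

/-- A game with as many winning profiles as each player has choices is a choice matching game. -/
theorem WLCGame.isomorphic_choiceMatching {n : ℕ} (G : WLCGame n) (m : ℕ) [NeZero m]
    (hc : ∀ i, Fintype.card (G.Choice i) = m) (hW : Nat.card G.Win = m) :
    G.Isomorphic (choiceMatching n m) := by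
  classical
  -- Each projection from the winning profiles is onto because every choice occurs in one, hence
  -- bijective by counting. Edges can thus be labelled by winning profiles.
  have hbij : ∀ i, Function.Bijective fun σ : G.Win => σ.1 i := fun i => by
    rw [Fintype.bijective_iff_surjective_and_card]
    refine ⟨fun c => ?_, by rw [← Nat.card_eq_fintype_card, hW, hc]⟩
    obtain ⟨σ, hσ, h⟩ := G.no_surely_losing i c
    exact ⟨⟨σ, hσ⟩, h⟩
  let e : G.Win ≃ Fin m := Finite.equivFinOfCardEq hW
  let w : ∀ i, G.Win ≃ G.Choice i := fun i => Equiv.ofBijective _ (hbij i)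
  have hw : ∀ i τ, w i τ = τ.1 i := fun _ _ => rfl
  refine ⟨⟨1, fun i => (w i).symm.trans e, fun σ => ?_, rfl⟩⟩
  constructor
  · intro hσ
    refine ⟨e ⟨σ, hσ⟩, fun i => ?_⟩
    change e ((w i).symm (σ i)) = _
    rw [EmbeddingLike.apply_eq_iff_eq, Equiv.symm_apply_eq]
    rfl
  · rintro ⟨k, hk⟩
    obtain ⟨τ, rfl⟩ := e.surjective k
    have : σ = τ.1 := funext fun i => by
      have h := hk i
      change e ((w i).symm (σ i)) = _ at h
      rw [EmbeddingLike.apply_eq_iff_eq, Equiv.symm_apply_eq] at h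
      exact h
    rw [this]
    exact τ.2

/-- With `x`, `y` choices and `w` winning pairs, the claim is `x * y < w * m`. Since `x, y ≤ m ≤ w`,
it can fail only if `x = y = w = m`, which forces a perfect matching. -/
theorem inv_lt_coordProb_of_not_isomorphic (m : ℕ) [NeZero m] (G : WLCGame 2)
    (hG : G.IsChoiceGame m) (hne : ¬ G.Isomorphic (choiceMatching 2 m)) :
    (m : ℝ≥0∞)⁻¹ < waitOrMove.coordProb G 0 [] := by
  rw [waitOrMove_coordProb_zero_nil]
  have h0 := G.card_choice_le_card_win 0
  have h1 := G.card_choice_le_card_win 1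
  have p0 : 0 < Fintype.card (G.Choice 0) := Fintype.card_pos
  have p1 : 0 < Fintype.card (G.Choice 1) := Fintype.card_pos
  have hiso : ¬ ((Fintype.card (G.Choice 0) = m ∧ Fintype.card (G.Choice 1) = m) ∧
      Nat.card G.Win = m) := fun h =>
    hne (G.isomorphic_choiceMatching m (Fin.forall_fin_two.2 h.1) h.2)
  rw [IsChoiceGame] at hG
  generalize Fintype.card (G.Choice 0) = x at *
  generalize Fintype.card (G.Choice 1) = y at *
  generalize Nat.card G.Win = w at *
  have hm : 0 < m := NeZero.pos m
  have key : x * y < w * m := by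
    have hx : x ≤ m := hG ▸ le_max_left _ _
    have hy : y ≤ m := hG ▸ le_max_right _ _
    have hw : m ≤ w := hG ▸ max_le h0 h1
    rcases hw.lt_or_eq with h | rfl
    · calc x * y ≤ m * m := Nat.mul_le_mul hx hy
        _ < w * m := Nat.mul_lt_mul_of_pos_right h hm
    · rcases hx.lt_or_eq with h | rfl
      · calc x * y ≤ x * m := Nat.mul_le_mul_left _ hy
          _ < m * m := Nat.mul_lt_mul_of_pos_right h hm
      · exact Nat.mul_lt_mul_of_pos_left (lt_of_le_of_ne hy fun h => hiso ⟨⟨rfl, h⟩, rfl⟩) hm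
  have hreal : (m : ℝ)⁻¹ < w * ((x : ℝ)⁻¹ * (y : ℝ)⁻¹) := by
    have : (x * y : ℝ) < w * m := by exact_mod_cast key
    have hx : (0 : ℝ) < x := by exact_mod_cast p0
    have hy : (0 : ℝ) < y := by exact_mod_cast p1
    have hm : (0 : ℝ) < m := by exact_mod_cast hm
    rw [← mul_inv, ← div_eq_mul_inv, inv_eq_one_div, div_lt_div_iff₀ hm (by positivity)]
    linarith
  rw [← ENNReal.toReal_lt_toReal (by simp [hm.ne'])
    (ENNReal.mul_ne_top (by simp) (ENNReal.mul_ne_top (by simp [p0.ne']) (by simp [p1.ne'])))]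
  simpa using hreal

/-! ### Lower bound: symmetric stages of the choice matching game -/

namespace ChoiceMatching

variable {m : ℕ} [NeZero m]

/-- The edge selected by the first player. -/
def firstEdge (σ : (choiceMatching 2 m).Profile) : Fin m := σ 0

/-- The edge selected by the second player. -/
def secondEdge (σ : (choiceMatching 2 m).Profile) : Fin m := σ 1

/-- The choice profile in which the players select the edges `a` and `b`. -/
def edgePair (a b : Fin m) : (choiceMatching 2 m).Profile := (choiceMatching 2 m).pair a b

@[simp] theorem firstEdge_edgePair (a b : Fin m) : firstEdge (edgePair a b) = a := rfl

@[simp] theorem secondEdge_edgePair (a b : Fin m) : secondEdge (edgePair a b) = b := rfl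

theorem edgePair_eta (σ : (choiceMatching 2 m).Profile) :
    edgePair (firstEdge σ) (secondEdge σ) = σ := pair_eta _ σ

theorem profile_ext {σ τ : (choiceMatching 2 m).Profile} (h0 : firstEdge σ = firstEdge τ)
    (h1 : secondEdge σ = secondEdge τ) : σ = τ := by
  rw [← edgePair_eta σ, ← edgePair_eta τ, h0, h1]

theorem sum_edges (F : (choiceMatching 2 m).Profile → ℝ≥0∞) :
    ∑ σ, F σ = ∑ a : Fin m, ∑ b : Fin m, F (edgePair a b) := sum_profile _ F

/-- The edge `c` of the choice matching game was not selected by any player so far. -/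
def Untouched (H : (choiceMatching 2 m).History) (c : Fin m) : Prop :=
  ∀ σ ∈ H, firstEdge σ ≠ c ∧ secondEdge σ ≠ c

/-- `τ` is an involution of the edges that interchanges the players' selections in every round and
whose fixed points are the untouched edges. -/
structure IsSymmetry (H : (choiceMatching 2 m).History) (τ : Equiv.Perm (Fin m)) : Prop where
  involutive : ∀ c, τ (τ c) = c
  fixed_iff : ∀ c, τ c = c ↔ Untouched H c
  history : ∀ σ ∈ H, τ (firstEdge σ) = secondEdge σ

open Classical in
/-- The number of untouched edges. -/
noncomputable def untouchedCount (H : (choiceMatching 2 m).History) : ℕ :=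
  (Finset.univ.filter (Untouched H)).card

theorem untouched_cons (σ : (choiceMatching 2 m).Profile) (H : (choiceMatching 2 m).History)
    (c : Fin m) : Untouched (σ :: H) c ↔ (firstEdge σ ≠ c ∧ secondEdge σ ≠ c) ∧ Untouched H c := by
  simp [Untouched]

/-- A lower bound, minus one, for the expected coordination time in a symmetric stage with `u`
untouched edges. -/
noncomputable def excess (u : ℕ) : ℝ≥0∞ := if u = 1 then 0 else if u = 3 then 2⁻¹ else 1

theorem excess_le_one (u : ℕ) : excess u ≤ 1 := by
  unfold excess
  split_ifs <;> simp

/-- The inequality that dictates the values of `excess`: the `u - 1` ways to pair an untouched edge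
with another one must together repay a win. A single untouched edge is a focal point allowing a sure
win, hence excess 0; this spoils `u = 3`, where 1/2 survives, and for `u = 5` the factor 4
compensates for that half. -/
theorem one_le_mul_excess {u : ℕ} (h1 : u ≠ 1) (h3 : u ≠ 3) (h0 : u ≠ 0) :
    1 ≤ ((u - 1 : ℕ) : ℝ≥0∞) * excess (u - 2) := by
  unfold excess
  rw [if_neg (by omega)]
  split_ifs with h
  · obtain rfl : u = 5 := by omega
    calc (1 : ℝ≥0∞) = 2 * 2⁻¹ := (ENNReal.mul_inv_cancel (by simp) (by simp)).symm
      _ ≤ _ := by gcongr; norm_num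
  · rw [mul_one]
    exact_mod_cast (by omega : 1 ≤ u - 1)

open Classical in
/-- The excess of a stage that has a symmetry, and `0` for the other stages. -/
noncomputable def stageExcess (H : (choiceMatching 2 m).History) : ℝ≥0∞ :=
  if ∃ τ, IsSymmetry H τ then excess (untouchedCount H) else 0

theorem IsSymmetry.stageExcess {H : (choiceMatching 2 m).History} {τ : Equiv.Perm (Fin m)}
    (h : IsSymmetry H τ) : stageExcess H = excess (untouchedCount H) :=
  if_pos ⟨τ, h⟩

theorem stageExcess_le_one (H : (choiceMatching 2 m).History) : stageExcess H ≤ 1 := by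
  unfold ChoiceMatching.stageExcess
  split_ifs
  · exact excess_le_one _
  · simp

theorem isSymmetry_nil : IsSymmetry ([] : (choiceMatching 2 m).History) 1 :=
  ⟨fun _ => rfl, fun c => by simp [Untouched], by simp⟩

theorem untouchedCount_nil : untouchedCount ([] : (choiceMatching 2 m).History) = m := by
  classical
  have h : Finset.univ.filter (Untouched ([] : (choiceMatching 2 m).History)) = Finset.univ :=
    Finset.filter_true_of_mem fun _ _ => by simp [Untouched]
  rw [untouchedCount, h, Finset.card_univ, Fintype.card_fin]

/-- Selecting a touched pair of edges again. -/
theorem IsSymmetry.cons_touched {H : (choiceMatching 2 m).History} {τ : Equiv.Perm (Fin m)}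
    (h : IsSymmetry H τ) {a : Fin m} (ha : ¬ Untouched H a) :
    IsSymmetry (edgePair a (τ a) :: H) τ ∧
      untouchedCount (edgePair a (τ a) :: H) = untouchedCount H := by
  have hτ : ¬ Untouched H (τ a) := by
    rw [← h.fixed_iff, h.involutive]
    exact fun e => ha ((h.fixed_iff a).1 e.symm)
  have hU : ∀ c, Untouched (edgePair a (τ a) :: H) c ↔ Untouched H c := fun c => by
    rw [untouched_cons, firstEdge_edgePair, secondEdge_edgePair, and_iff_right_iff_imp]
    intro hc
    exact ⟨fun e => ha (e ▸ hc), fun e => hτ (e ▸ hc)⟩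
  refine ⟨⟨h.involutive, fun c => by rw [hU, h.fixed_iff], fun σ hσ => ?_⟩, ?_⟩
  · rcases List.mem_cons.1 hσ with rfl | hσ
    · rfl
    · exact h.history σ hσ
  · refine congrArg Finset.card ?_
    ext c
    simp only [Finset.mem_filter, hU]

/-- Selecting two distinct untouched edges. -/
theorem IsSymmetry.cons_untouched {H : (choiceMatching 2 m).History} {τ : Equiv.Perm (Fin m)}
    (h : IsSymmetry H τ) {a b : Fin m} (ha : Untouched H a) (hb : Untouched H b) (hab : a ≠ b) :
    IsSymmetry (edgePair a b :: H) (τ * Equiv.swap a b) ∧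
      untouchedCount (edgePair a b :: H) = untouchedCount H - 2 := by
  classical
  have ea := (h.fixed_iff a).2 ha
  have eb := (h.fixed_iff b).2 hb
  -- As `τ` fixes the untouched edges `a` and `b`, the product adds the 2-cycle `(a b)` and agrees
  -- with `τ` elsewhere.
  have va : (τ * Equiv.swap a b) a = b := by simp [eb]
  have vb : (τ * Equiv.swap a b) b = a := by simp [ea]
  have vc : ∀ c, c ≠ a → c ≠ b → (τ * Equiv.swap a b) c = τ c := fun c h1 h2 => by
    simp [Equiv.swap_apply_of_ne_of_ne h1 h2]
  have hU : ∀ c, Untouched (edgePair a b :: H) c ↔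
      (a ≠ c ∧ b ≠ c) ∧ Untouched H c := fun c => untouched_cons ..
  refine ⟨⟨fun c => ?_, fun c => ?_, fun σ hσ => ?_⟩, ?_⟩
  · by_cases h1 : c = a
    · rw [h1, va, vb]
    by_cases h2 : c = b
    · rw [h2, vb, va]
    rw [vc c h1 h2, vc, h.involutive]
    · exact fun e => h1 (by rw [← h.involutive c, e, ea])
    · exact fun e => h2 (by rw [← h.involutive c, e, eb])
  · rw [hU]
    by_cases h1 : c = a
    · rw [h1, va]; simp [hab.symm]
    by_cases h2 : c = b
    · rw [h2, vb]; simp [hab]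
    rw [vc c h1 h2, h.fixed_iff, and_iff_right ⟨Ne.symm h1, Ne.symm h2⟩]
  · rcases List.mem_cons.1 hσ with rfl | hσ
    · exact va
    · have h0 : firstEdge σ ≠ a := (ha σ hσ).1
      have h1 : firstEdge σ ≠ b := (hb σ hσ).1
      rw [vc _ h0 h1]
      exact h.history σ hσ
  · have : Finset.univ.filter (Untouched (edgePair a b :: H))
        = Finset.univ.filter (Untouched H) \ {a, b} := by
      ext c
      simp only [Finset.mem_filter, Finset.mem_univ, true_and, hU, Finset.mem_sdiff,
        Finset.mem_insert, Finset.mem_singleton, not_or, ne_eq, eq_comm (a := c)]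
      tauto
    unfold untouchedCount
    rw [this, Finset.card_sdiff_of_subset, Finset.card_pair hab]
    intro c hc
    rcases Finset.mem_insert.1 hc with rfl | hc
    · simpa using ha
    · rw [Finset.mem_singleton.1 hc]; simpa using hb

/-! ### Structural protocols in symmetric stages -/

variable (π : Protocol 2)

/-- The probability that player `i` selects the edge `c`. -/
noncomputable def prob (H : (choiceMatching 2 m).History) (i : Fin 2) (c : Fin m) : ℝ≥0∞ :=
  π.dist (choiceMatching 2 m) H i c

theorem sum_prob (H : (choiceMatching 2 m).History) (i : Fin 2) : ∑ c, prob π H i c = 1 := by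
  rw [← tsum_fintype (L := .unconditional _)]
  exact PMF.tsum_coe (π.dist (choiceMatching 2 m) H i)

theorem roundProb_edgePair (H : (choiceMatching 2 m).History) (a b : Fin m) :
    π.roundProb (choiceMatching 2 m) H (edgePair a b) = prob π H 0 a * prob π H 1 b :=
  π.roundProb_pair _ H _ _

theorem mem_win (σ : (choiceMatching 2 m).Profile) :
    σ ∈ (choiceMatching 2 m).Win ↔ firstEdge σ = secondEdge σ := by
  constructor
  · rintro ⟨k, hk⟩
    exact (hk 0).trans (hk 1).symm
  · intro h
    exact ⟨secondEdge σ, Fin.forall_fin_two.2 ⟨h, rfl⟩⟩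

/-- Symmetric edges are selected with the same probability by the two players. -/
theorem IsSymmetry.prob_eq {H : (choiceMatching 2 m).History} {τ : Equiv.Perm (Fin m)}
    (h : IsSymmetry H τ) (c : Fin m) : prob π H 1 (τ c) = prob π H 0 c := by
  -- The renaming interchanges the players and applies `τ` to the edges; it fixes the history
  -- because `τ` exchanges the two selections of every round.
  refine (π.structural _ H _ H
    ⟨Equiv.swap 0 1, fun _ => τ, fun σ => ?_, ?_⟩ 1 c).symm
  · rw [mem_win, mem_win]
    change _ ↔ τ (secondEdge σ) = τ (firstEdge σ)
    rw [EmbeddingLike.apply_eq_iff_eq, eq_comm]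
  · refine ((List.map_congr_left fun σ hσ => ?_).trans (List.map_id H)).symm
    have e := h.history σ hσ
    refine profile_ext ?_ e
    change τ (secondEdge σ) = firstEdge σ
    rw [← e, h.involutive]

/-- Untouched edges are selected with the same probability. -/
theorem prob_eq_of_untouched {H : (choiceMatching 2 m).History} {a b : Fin m}
    (ha : Untouched H a) (hb : Untouched H b) (i : Fin 2) : prob π H i a = prob π H i b := by
  have hs := π.structural _ H _ H
    ⟨1, fun _ => (Equiv.swap a b : Equiv.Perm (Fin m)), fun σ => ?_, ?_⟩ i a
  · refine hs.trans ?_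
    change prob π H i (Equiv.swap a b a) = _
    rw [Equiv.swap_apply_left]
  · rw [mem_win, mem_win]
    change _ ↔ Equiv.swap a b (firstEdge σ) = Equiv.swap a b (secondEdge σ)
    exact (EmbeddingLike.apply_eq_iff_eq (Equiv.swap a b)).symm
  · refine ((List.map_congr_left fun σ hσ => ?_).trans (List.map_id H)).symm
    exact profile_ext (Equiv.swap_apply_of_ne_of_ne (ha σ hσ).1 (hb σ hσ).1)
      (Equiv.swap_apply_of_ne_of_ne (ha σ hσ).2 (hb σ hσ).2)

open Classical in
theorem sum_nonwinning (H : (choiceMatching 2 m).History)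
    (f : (choiceMatching 2 m).Profile → ℝ≥0∞) :
    (∑ σ : (choiceMatching 2 m).Profile, if σ ∈ (choiceMatching 2 m).Win then 0 else
      π.roundProb (choiceMatching 2 m) H σ * f σ) = ∑ a : Fin m, ∑ b : Fin m,
        if a = b then 0 else
          prob π H 0 a * prob π H 1 b * f (edgePair a b) := by
  rw [sum_edges]
  simp only [mem_win, roundProb_edgePair, firstEdge_edgePair, secondEdge_edgePair]

theorem coordProb_zero (H : (choiceMatching 2 m).History) :
    π.coordProb (choiceMatching 2 m) 0 H = ∑ a : Fin m, prob π H 0 a * prob π H 1 a := by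
  classical
  have : π.coordProb (choiceMatching 2 m) 0 H = ∑ a : Fin m, ∑ b : Fin m,
      if a = b then prob π H 0 a * prob π H 1 b else 0 := by
    rw [Protocol.coordProb, sum_edges]
    simp only [mem_win, roundProb_edgePair, firstEdge_edgePair, secondEdge_edgePair]
  rw [this]
  simp

theorem two_mul_mul_le_sq_add_sq (a b : ℝ≥0∞) : 2 * (a * b) ≤ a * a + b * b := by
  wlog h : a ≤ b generalizing a b
  · rw [mul_comm a b, add_comm]
    exact this b a (le_of_not_ge h)
  obtain ⟨c, rfl⟩ := exists_add_of_le h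
  calc 2 * (a * (a + c)) ≤ 2 * (a * (a + c)) + c * c := le_self_add
    _ = _ := by ring

/-- Both players select `a` with probability `p a * p (τ a)`, which is at most the mean of the two
squares; summing over `a` and reindexing by `τ` gives the bound. -/
theorem IsSymmetry.coordProb_zero_le {H : (choiceMatching 2 m).History}
    {τ : Equiv.Perm (Fin m)} (h : IsSymmetry H τ) :
    π.coordProb (choiceMatching 2 m) 0 H ≤ ∑ a : Fin m, prob π H 0 a * prob π H 0 a := by
  rw [coordProb_zero]
  have e : ∀ a, prob π H 1 a = prob π H 0 (τ a) := fun a => by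
    rw [← h.prob_eq π (τ a), h.involutive]
  have h2 : 2 * ∑ a : Fin m, prob π H 0 a * prob π H 1 a
      ≤ 2 * ∑ a : Fin m, prob π H 0 a * prob π H 0 a := by
    calc 2 * ∑ a : Fin m, prob π H 0 a * prob π H 1 a
        ≤ ∑ a : Fin m, (prob π H 0 a * prob π H 0 a + prob π H 0 (τ a) * prob π H 0 (τ a)) := by
          rw [Finset.mul_sum]
          gcongr with a
          rw [e]
          exact two_mul_mul_le_sq_add_sq _ _
      _ = _ := by
        rw [Finset.sum_add_distrib,
          Equiv.sum_comp τ fun a => prob π H 0 a * prob π H 0 a, two_mul]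
  exact (ENNReal.mul_le_mul_iff_right (by simp) (by simp)).1 h2

open Classical in
/-- The probability of failing weighted by `f` dominates the probability of winning if `f` is at
least `1` after a repetition of a touched pair of edges, and at least `(u - 1)⁻¹` after the
selection of two new edges. -/
theorem IsSymmetry.coordProb_zero_le_sum {H : (choiceMatching 2 m).History}
    {τ : Equiv.Perm (Fin m)} (h : IsSymmetry H τ) (f : (choiceMatching 2 m).Profile → ℝ≥0∞)
    (x : ℝ≥0∞) (h1 : ∀ a, ¬ Untouched H a → 1 ≤ f (edgePair a (τ a)))
    (h2 : ∀ a b, Untouched H a → Untouched H b → a ≠ b →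
      x ≤ f (edgePair a b))
    (hx : untouchedCount H ≠ 0 → 1 ≤ ((untouchedCount H - 1 : ℕ) : ℝ≥0∞) * x) :
    π.coordProb (choiceMatching 2 m) 0 H ≤ ∑ σ : (choiceMatching 2 m).Profile,
      if σ ∈ (choiceMatching 2 m).Win then 0 else
        π.roundProb (choiceMatching 2 m) H σ * f σ := by
  refine (h.coordProb_zero_le π).trans ?_
  rw [sum_nonwinning]
  refine Finset.sum_le_sum fun a _ => ?_
  by_cases ha : Untouched H a
  -- For untouched `a`, the square is charged to the pairs `(a, b)` with `b` another untouched edge: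
  -- there are `u - 1` of them, each with probability exactly this square.
  · let S := (Finset.univ.filter (Untouched H)).erase a
    have hS : S.card = untouchedCount H - 1 := Finset.card_erase_of_mem (by simpa using ha)
    have h0 : untouchedCount H ≠ 0 :=
      Finset.card_ne_zero_of_mem (a := a) (by simpa using ha)
    have hpa : prob π H 1 a = prob π H 0 a := by
      conv_lhs => rw [← (h.fixed_iff a).2 ha]
      exact h.prob_eq π a
    calc prob π H 0 a * prob π H 0 a
        ≤ (((untouchedCount H - 1 : ℕ) : ℝ≥0∞) * x) * (prob π H 0 a * prob π H 0 a) :=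
          le_mul_of_one_le_left zero_le (hx h0)
      _ = ∑ b ∈ S, prob π H 0 a * prob π H 0 a * x := by
          rw [Finset.sum_const, hS, nsmul_eq_mul]; ring
      _ ≤ ∑ b ∈ S, if a = b then 0 else
          prob π H 0 a * prob π H 1 b * f (edgePair a b) := by
          refine Finset.sum_le_sum fun b hb => ?_
          obtain ⟨hba, hb⟩ := Finset.mem_erase.1 hb
          have hb : Untouched H b := by simpa using hb
          rw [if_neg (Ne.symm hba), prob_eq_of_untouched π hb ha, hpa]
          gcongr
          exact h2 a b ha hb (Ne.symm hba)
      _ ≤ _ := Finset.sum_le_univ_sum_of_nonneg fun _ => zero_le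
  -- For touched `a`, the square is the probability of the single losing pair `(a, τ a)`.
  · calc prob π H 0 a * prob π H 0 a
        ≤ prob π H 0 a * prob π H 1 (τ a) * f (edgePair a (τ a)) := by
          rw [h.prob_eq π]
          exact le_mul_of_one_le_right zero_le (h1 a ha)
      _ = if a = τ a then 0 else
          prob π H 0 a * prob π H 1 (τ a) * f (edgePair a (τ a)) := by
          rw [if_neg fun e => ha ((h.fixed_iff a).1 e.symm)]
      _ ≤ _ := Finset.single_le_sum (f := fun b => if a = b then 0 else
          prob π H 0 a * prob π H 1 b * f (edgePair a b))
          (fun _ _ => zero_le) (Finset.mem_univ (τ a))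

open Classical in
-- One-step inequality for the potential `1 + stageExcess`. Stages without a symmetry need only the
-- trivial bound of one round.
theorem stageExcess_le (H : (choiceMatching 2 m).History) :
    stageExcess H ≤ ∑ σ : (choiceMatching 2 m).Profile,
      if σ ∈ (choiceMatching 2 m).Win then 0 else
        π.roundProb (choiceMatching 2 m) H σ * (1 + stageExcess (σ :: H)) := by
  by_cases hτ : ∃ τ, IsSymmetry H τ
  swap
  · rw [ChoiceMatching.stageExcess, if_neg hτ]
    exact zero_le
  obtain ⟨τ, h⟩ := hτ
  have hone := π.coordProb_add_failProb (choiceMatching 2 m) 0 H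
  simp only [Protocol.failProb, mul_one] at hone
  by_cases hu1 : untouchedCount H = 1
  · rw [h.stageExcess, excess, if_pos hu1]
    exact zero_le
  by_cases hu3 : untouchedCount H = 3
  -- With constant weight 1, winning is no more likely than failing, so failing has probability at
  -- least 1/2.
  · have hw := h.coordProb_zero_le_sum π (fun _ => 1) 1 (fun _ _ => le_rfl)
      (fun _ _ _ _ _ => le_rfl) (fun _ => by rw [hu3]; norm_num)
    simp only [mul_one] at hw
    have e : stageExcess H = 2⁻¹ := by
      rw [h.stageExcess, excess, if_neg hu1, if_pos hu3]
    rw [e]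
    refine le_trans (b := ∑ σ : (choiceMatching 2 m).Profile,
      if σ ∈ (choiceMatching 2 m).Win then 0 else π.roundProb (choiceMatching 2 m) H σ) ?_ ?_
    · by_contra! hlt
      have := ENNReal.add_lt_add (hw.trans_lt hlt) hlt
      rw [hone, ENNReal.inv_two_add_inv_two] at this
      exact lt_irrefl _ this
    · gcongr with σ
      split_ifs
      · exact le_rfl
      · exact le_mul_of_one_le_right zero_le le_self_add
  · have e : stageExcess H = 1 := by
      rw [h.stageExcess, excess, if_neg hu1, if_neg hu3]
    have hw := h.coordProb_zero_le_sum π (fun σ => stageExcess (σ :: H))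
      (excess (untouchedCount H - 2))
      (fun a ha => by
        obtain ⟨h', hc⟩ := h.cons_touched ha
        rw [h'.stageExcess, hc, ← h.stageExcess, e])
      (fun a b ha hb hab => by
        obtain ⟨h', hc⟩ := h.cons_untouched ha hb hab
        rw [h'.stageExcess, hc])
      (fun h0 => one_le_mul_excess hu1 hu3 h0)
    rw [e]
    -- Winning and failing probabilities add up to 1, so excess 1 only requires the winning
    -- probability to be at most the expected excess after failing.
    refine (hone.symm.trans_le (add_le_add_left hw _)).trans_eq ?_
    rw [← Finset.sum_add_distrib]
    refine Finset.sum_congr rfl fun σ _ => ?_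
    split_ifs
    · simp
    · ring

theorem one_add_stageExcess_le_ectFrom (H : (choiceMatching 2 m).History) :
    1 + stageExcess H ≤ π.ectFrom (choiceMatching 2 m) H := by
  refine π.le_ectFrom_of_le_step _ (fun H => 1 + stageExcess H) (fun H => ?_) (fun H => ?_) H
  · calc 1 + stageExcess H ≤ 1 + 1 := by gcongr; exact stageExcess_le_one H
      _ = 2 := one_add_one_eq_two
  · gcongr
    exact stageExcess_le π H

/-- Initially all edges are untouched, so structurality forces the uniform distribution. -/
theorem coordProb_zero_nil :
    π.coordProb (choiceMatching 2 m) 0 [] = (m : ℝ≥0∞)⁻¹ := by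
  have hU : ∀ c : Fin m, Untouched ([] : (choiceMatching 2 m).History) c := by simp [Untouched]
  have hp : ∀ i c, prob π ([] : (choiceMatching 2 m).History) i c = (m : ℝ≥0∞)⁻¹ := by
    intro i c
    have hs := sum_prob π ([] : (choiceMatching 2 m).History) i
    rw [Finset.sum_congr rfl fun a _ => prob_eq_of_untouched π (hU a) (hU c) i,
      Finset.sum_const, Finset.card_univ, Fintype.card_fin, nsmul_eq_mul, mul_comm] at hs
    exact ENNReal.eq_inv_of_mul_eq_one_left hs
  rw [coordProb_zero]
  simp only [hp, Finset.sum_const, Finset.card_univ, Fintype.card_fin, nsmul_eq_mul]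
  rw [← mul_assoc, ENNReal.mul_inv_cancel (by simp [NeZero.ne]) (by simp), one_mul]

/-- The lower bound for the expected coordination time in choice matching games. -/
theorem le_ect (h3 : m ≠ 3) (h5 : m ≠ 5) :
    1 + 2 * (1 - (m : ℝ≥0∞)⁻¹) ≤ π.ect (choiceMatching 2 m) := by
  rw [← coordProb_zero_nil π, ← Protocol.failProb_one_eq, Protocol.ect, Protocol.ectFrom_eq,
    Protocol.failProb, Finset.mul_sum]
  gcongr with σ
  split_ifs with hσ
  · simp
  · rw [Protocol.failProb, mul_one, mul_comm]
    gcongr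
    rw [mem_win] at hσ
    obtain ⟨h', hc⟩ := (isSymmetry_nil (m := m)).cons_untouched (a := firstEdge σ) (b := secondEdge σ)
      (by simp [Untouched]) (by simp [Untouched]) hσ
    -- After the lost round `m - 2` edges are untouched; the excess there is 1 because `m ≠ 3` and
    -- `m ≠ 5`.
    have hle := one_add_stageExcess_le_ectFrom π [edgePair (firstEdge σ) (secondEdge σ)]
    rw [h'.stageExcess, hc, untouchedCount_nil] at hle
    rw [edgePair_eta, excess] at hle
    have hm2 : 2 ≤ m := by
      by_contra! hlt
      have : m = 1 := le_antisymm (by omega) (NeZero.pos m)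
      subst this
      exact hσ (Subsingleton.elim (α := Fin 1) _ _)
    rwa [if_neg (by omega), if_neg (by omega), one_add_one_eq_two] at hle

end ChoiceMatching

/-! ### Comparison of the two bounds -/

theorem mainTheorem7 (m : ℕ) [NeZero m] (h1 : m ≠ 1) (h3 : m ≠ 3) (h5 : m ≠ 5)
    (G : WLCGame 2) (hG : G.IsChoiceGame m)
    (hne : ¬ G.Isomorphic (WLCGame.choiceMatching 2 m)) :
    ∃ r : ENNReal, IsOptimalECT (WLCGame.choiceMatching 2 m) r ∧ waitOrMove.ect G < r := by
  refine ⟨waitOrMove.ect (choiceMatching 2 m), ⟨⟨waitOrMove, rfl⟩, ?_⟩, ?_⟩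
  · rintro _ ⟨π, rfl⟩
    refine le_trans ?_ (ChoiceMatching.le_ect π h3 h5)
    rw [← ChoiceMatching.coordProb_zero_nil waitOrMove]
    exact waitOrMove_ect_le _
  · refine lt_of_lt_of_le (lt_of_le_of_lt (waitOrMove_ect_le G) ?_)
      (ChoiceMatching.le_ect waitOrMove h3 h5)
    refine ENNReal.add_lt_add_left ENNReal.one_ne_top
      (ENNReal.mul_lt_mul_right (by simp) (by simp) ?_)
    have h := inv_lt_coordProb_of_not_isomorphic m G hG hne
    have hm : (m : ℝ≥0∞)⁻¹ ≤ 1 := by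
      rw [ENNReal.inv_le_one]
      exact_mod_cast NeZero.one_le
    refine ENNReal.sub_lt_of_sub_lt ?_ (.inl ENNReal.one_ne_top) ?_
    · exact le_self_add.trans_eq (waitOrMove.coordProb_add_failProb G 0 [])
    · rwa [ENNReal.sub_sub_cancel ENNReal.one_ne_top hm]
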